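/- Let $p$ be a prime, $q=p^s$ with $s>1$ an integer, $0<i<s$ an integer, and $m=\gcd(i,s)$. Let $U_{q+1}$ be the group of $(q+1)$-th roots of unity in $\mathbb{F}_{q^2}$ and let $\beta\in\mathbb{F}_{q^2}$ be a primitive $(q+1)$-th root of unity. For an integer $h\ge 0$ let $\mathcal{C}_{(q,q+1,3,h)}$ be the BCH code of length $q+1$ over $\mathbb{F}_q$ with designed distance $3$, i.e. the set of $(c_0,\dots,c_q)\in\mathbb{F}_q^{q+1}$ such that $c_0+c_1X+\cdots+c_qX^q$ lies in the ideal of $\mathbb{F}_q[X]/(X^{q+1}-1)$ generated by the least common multiple of the minimal polynomials of $\beta^h$ and $\beta^{h+1}$ over $\mathbb{F}_q$. The incidence structure supported by the minimum weight codewords of a nonzero code $\mathcal{C}$ of length $n$ over $\mathbb{F}_q$ has the points $0,\dots,n-1$, and its multiset of blocks consists of the supports of the codewords of minimum nonzero weight, with all multiplicities divided by $q-1$. A $t$-$(n,k,\lambda)$ design (possibly with $\lambda=0$) has $n$ points and blocks of size $k$ such that every $t$-subset of the points lies in exactly $\lambda$ blocks; it is simple if it has no repeated blocks. Two such structures are isomorphic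 if a bijection between the points maps the multiset of blocks of one onto that of the other. Put $$M(x,y,z,w)=\begin{bmatrix}1&1&1&1\\x&y&z&w\\x^{p^i}&y^{p^i}&z^{p^i}&w^{p^i}\\x^{p^i+1}&y^{p^i+1}&z^{p^i+1}&w^{p^i+1}\end{bmatrix},\qquad \mathcal{B}=\left\{\{x,y,z,w\}\in\binom{U_{q+1}}{4}:\det M(x,y,z,w)=0\right\},$$ where $\binom{U_{q+1}}{4}$ is the set of all $4$-subsets of $U_{q+1}$. (1) $(U_{q+1},\mathcal{B})$ is a simple $3$-$(q+1,4,p^m-2)$ design. (2) Suppose that $p^m\ge 3$, and let $h=\frac{q-p^i}{2}$ ($p$ arbitrary) or $h=\frac{p^i-1}{2}$ ($p$ odd). Then the minimum weight codewords of $\mathcal{C}_{(q,q+1,3,h)}$ support a simple $3$-$(q+1,4,p^m-2)$ design, and $(U_{q+1},\mathcal{B})$ is isomorphic to it. (3) If $p$ is odd, then the $3$-$(q+1,4,p^m-2)$ designs supported by the minimum weight codewords of $\mathcal{C}_{(q,q+1,3,\frac{q-p^i}{2})}$ and of $\mathcal{C}_{(q,q+1,3,\frac{p^i-1}{2})}$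 are isomorphic. -/

import Mathlib

open Polynomial

noncomputable section

/-! ### Incidence structures and designs

An incidence structure on a point type `P` is given by its multiset of blocks. -/

open scoped Classical in
/-- The pair `(P, B)` is a `t`-`(n, k, l)` design: there are `n` points, every block (repeated
blocks are allowed) has `k` points, and every `t`-subset of the points is contained in exactly
`l` blocks, counted with multiplicity. -/
structure IsDesign {P : Type*} (B : Multiset (Finset P)) (t n k l : ℕ) : Prop where
  card_points : Nat.card P = n
  one_le : 1 ≤ t
  le_block : t ≤ k
  card_block : ∀ b ∈ B, b.card = k
  regular : ∀ T : Finset P, T.card = t → B.countP (fun b => T ⊆ b) = l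

/-- A simple design: a design without repeated blocks. -/
structure IsSimpleDesign {P : Type*} (B : Multiset (Finset P)) (t n k l : ℕ) : Prop extends
    IsDesign B t n k l where
  nodup : B.Nodup

/-- `(P, B)` and `(Q, B')` are isomorphic: some bijection of the points carries the multiset of
blocks of the first to the multiset of blocks of the second. -/
def DesignIso {P Q : Type*} (B : Multiset (Finset P)) (B' : Multiset (Finset Q)) : Prop :=
  ∃ e : P ≃ Q, B.map (fun b => b.map e.toEmbedding) = B'

/-! ### Linear codes and the incidence structures they support -/

open scoped Classical in
/-- The set of coordinate positions at which `c` is nonzero. -/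
def codeSupport {F : Type*} [Field F] {n : ℕ} (c : Fin n → F) : Finset (Fin n) :=
  Finset.univ.filter fun j => c j ≠ 0

open scoped Classical in
/-- The minimum distance of a linear code: the least Hamming weight of a nonzero codeword. -/
def codeMinDist {F : Type*} [Field F] {n : ℕ} (C : Submodule F (Fin n → F)) : ℕ :=
  sInf {w | ∃ c ∈ C, c ≠ 0 ∧ hammingNorm c = w}

open scoped Classical in
/-- Divide the multiplicity of every element of a multiset by `a`. -/
def divMultiplicity {α : Type*} (a : ℕ) (S : Multiset α) : Multiset α :=
  ∑ x ∈ S.toFinset, Multiset.replicate (S.count x / a) x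

open scoped Classical in
/-- The multiset of the supports of the codewords of weight `k` in `C`, with all multiplicities
divided by `q - 1`, where `q` is the size of the field.  For `k ≠ 0` the division is exact, since
the nonzero scalars act freely on the codewords with a given nonempty support. -/
def codeBlocks {F : Type*} [Field F] [Fintype F] {n : ℕ} (C : Submodule F (Fin n → F)) (k : ℕ) :
    Multiset (Finset (Fin n)) :=
  divMultiplicity (Fintype.card F - 1)
    ((Finset.univ.filter fun c : Fin n → F => c ∈ C ∧ hammingNorm c = k).val.map codeSupport)

/-- The blocks supported by the codewords of minimum weight. -/
def minWeightBlocks {F : Type*} [Field F] [Fintype F] {n : ℕ} (C : Submodule F (Fin n → F)) :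
    Multiset (Finset (Fin n)) :=
  codeBlocks C (codeMinDist C)

/-! ### Cyclic codes and BCH codes -/

/-- The identification of `F ^ n` with `F[X] / (X ^ n - 1)`,
`(c₀, …, cₙ₋₁) ↦ c₀ + c₁ X + ⋯ + cₙ₋₁ X ^ (n - 1)`. -/
def wordToQuotient (F : Type*) [Field F] (n : ℕ) :
    (Fin n → F) →ₗ[F] F[X] ⧸ Ideal.span {(X ^ n - 1 : F[X])} :=
  (Ideal.Quotient.mkₐ F (Ideal.span {(X ^ n - 1 : F[X])})).toLinearMap ∘ₗ
    ∑ j : Fin n, (Polynomial.monomial (j : ℕ)) ∘ₗ LinearMap.proj j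

/-- The cyclic code of length `n` generated by `g`: the words that correspond to elements of the
ideal of `F[X] / (X ^ n - 1)` generated by the class of `g`. -/
def cyclicCode {F : Type*} [Field F] (n : ℕ) (g : F[X]) : Submodule F (Fin n → F) :=
  ((Ideal.span {Ideal.Quotient.mk (Ideal.span {(X ^ n - 1 : F[X])}) g}).restrictScalars F).comap
    (wordToQuotient F n)

open scoped Classical in
/-- The polynomial `lcm (M_{β^h}, M_{β^(h+1)}, …, M_{β^(h+δ-2)})` over `F`, where `M_b` is the
minimal polynomial of `b` over `F`. -/
def bchGenerator (F : Type*) [Field F] {E : Type*} [Field E] [Algebra F E] (δ h : ℕ) (β : E) :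
    F[X] :=
  letI : NormalizedGCDMonoid F[X] := UniqueFactorizationMonoid.toNormalizedGCDMonoid F[X]
  (Finset.range (δ - 1)).lcm fun j => minpoly F (β ^ (h + j))

/-- The BCH code over `F` of length `n` and designed distance `δ` with offset `h`, with respect to
the primitive `n`-th root of unity `β`. -/
def bchCode (F : Type*) [Field F] {E : Type*} [Field E] [Algebra F E] (n δ h : ℕ) (β : E) :
    Submodule F (Fin n → F) :=
  cyclicCode n (bchGenerator F δ h β)

/-! ### The determinant and its zero blocks -/

/-- The matrix with rows `(1, 1, 1, 1)`, `(x, y, z, w)`, `(x ^ r, y ^ r, z ^ r, w ^ r)` and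
`(x ^ (r + 1), y ^ (r + 1), z ^ (r + 1), w ^ (r + 1))`. -/
def fourMatrix {E : Type*} [Field E] (r : ℕ) (x y z w : E) : Matrix (Fin 4) (Fin 4) E :=
  !![1, 1, 1, 1;
     x, y, z, w;
     x ^ r, y ^ r, z ^ r, w ^ r;
     x ^ (r + 1), y ^ (r + 1), z ^ (r + 1), w ^ (r + 1)]

open scoped Classical in
/-- The 4-subsets `{x, y, z, w}` of the group of `l`-th roots of unity of `E` on which the
determinant of `fourMatrix r x y z w` vanishes. -/
def detBlocks (E : Type*) [Field E] (l : ℕ) [NeZero l] (r : ℕ) :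
    Finset (Finset (rootsOfUnity l E)) :=
  letI : Fintype (rootsOfUnity l E) := Fintype.ofFinite _
  Finset.univ.filter fun S => S.card = 4 ∧ ∃ x y z w : rootsOfUnity l E, S = {x, y, z, w} ∧
    (fourMatrix r ((x : Eˣ) : E) ((y : Eˣ) : E) ((z : Eˣ) : E) ((w : Eˣ) : E)).det = 0

end

/-! Put r = p^i, A = (x-z)(y-w) and B = (x-w)(y-z). As u ↦ u^r is additive, the determinant is A·B^r
- B·A^r, so for distinct points it vanishes exactly when the cross-ratio A/B is fixed by the r-th
power map.

On U_{q+1} the q-th power map is inversion, a Möbius map, so cross-ratios of points of U_{q+1} lie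
in F_q. Conversely, given distinct x, y, z in U_{q+1}, every c in F_q other than 0 and 1 is the
cross-ratio for exactly one further w in U_{q+1}. Hence the blocks through x, y, z correspond to the
elements c ≠ 0, 1 with c^(p^i) = c = c^(p^s), that is, to F_{p^m} without 0 and 1. This gives λ =
p^m - 2 (`detBlocks_isSimpleDesign`).

For the codes, a word over F_q with zeros β^h and β^(h+1) also has the zeros β^(-h) and β^(-h-1).
For both choices of h, multiplying coordinate j by a power of β^j turns these four checks into the
rows of M (`exists_rescaling`). Any three columns are independent (`sum_columns_three`), so the
distance is at least 4, and the 4-sets carrying a word over F_{q^2} are the blocks. Such a word has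
a scalar multiple over F_q and is unique up to scalars (`minWeightBlocks_eq`), so j ↦ β^j is an
isomorphism as soon as there is a block, which p^m ≥ 3 ensures. Composing two such isomorphisms
gives (3). -/

/-! ### The determinant and cross-ratios on U_{q+1}. -/

lemma fourMatrix_det {E : Type*} [Field E] (r : ℕ) (x y z w : E) :
    (fourMatrix r x y z w).det =
      (x - z) * (y - w) * ((x ^ r - w ^ r) * (y ^ r - z ^ r)) -
        (x - w) * (y - z) * ((x ^ r - z ^ r) * (y ^ r - w ^ r)) := by
  simp only [fourMatrix, pow_succ]
  generalize x ^ r = X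
  generalize y ^ r = Y
  generalize z ^ r = Z
  generalize w ^ r = W
  simp [Matrix.det_succ_row_zero, Fin.sum_univ_succ, Fin.succAbove]
  ring

/-- The cross-ratio of four elements of a field. -/
def crossRatio {E : Type*} [Field E] (x y z w : E) : E :=
  (x - z) * (y - w) / ((x - w) * (y - z))

lemma crossRatio_sub_one {E : Type*} [Field E] {x y z w : E} (hxw : x ≠ w) (hyz : y ≠ z) :
    crossRatio x y z w - 1 = (x - y) * (z - w) / ((x - w) * (y - z)) := by
  have h1 := sub_ne_zero.2 hxw
  have h2 := sub_ne_zero.2 hyz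
  unfold crossRatio
  field_simp
  ring

lemma fourMatrix_det_eq_zero_iff {E : Type*} [Field E] (p i : ℕ) [Fact p.Prime] [CharP E p]
    {x y z w : E} (hxw : x ≠ w) (hyz : y ≠ z) :
    (fourMatrix (p ^ i) x y z w).det = 0 ↔ crossRatio x y z w ^ p ^ i = crossRatio x y z w := by
  have h1 := sub_ne_zero.2 hxw
  have h2 := sub_ne_zero.2 hyz
  rw [fourMatrix_det, ← sub_pow_char_pow, ← sub_pow_char_pow, ← sub_pow_char_pow,
    ← sub_pow_char_pow, ← mul_pow, ← mul_pow, crossRatio, div_pow,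
    div_eq_div_iff (by positivity) (by positivity), sub_eq_zero]
  constructor <;> intro h <;> linear_combination -h

lemma crossRatio_injective {E : Type*} [Field E] {x y z w w' : E} (hxy : x ≠ y) (hxz : x ≠ z)
    (hyz : y ≠ z) (hxw : x ≠ w) (hxw' : x ≠ w')
    (h : crossRatio x y z w = crossRatio x y z w') : w = w' := by
  have h1 := sub_ne_zero.2 hxy
  have h2 := sub_ne_zero.2 hyz
  have h3 := sub_ne_zero.2 hxz
  have h4 := sub_ne_zero.2 hxw
  have h5 := sub_ne_zero.2 hxw'
  rw [crossRatio, crossRatio, div_eq_div_iff (by positivity) (by positivity)] at h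
  have : (x - z) * (y - z) * (x - y) * (w - w') = 0 := by linear_combination -h
  have h6 : (x - z) * (y - z) * (x - y) ≠ 0 := by positivity
  exact sub_eq_zero.1 ((mul_eq_zero.1 this).resolve_left h6)

/-- The fixed points of `c ↦ c ^ a` and `c ↦ c ^ b`. -/
lemma pow_prime_pow_gcd {E : Type*} [Field E] (p i s : ℕ) [Fact p.Prime] [CharP E p] (c : E) :
    c ^ p ^ i = c ∧ c ^ p ^ s = c ↔ c ^ p ^ Nat.gcd i s = c := by
  -- The exponents in question are the periods of c under Frobenius, and periods are closed under
  -- gcd.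
  have key (n : ℕ) : Function.IsPeriodicPt (frobenius E p) n c ↔ c ^ p ^ n = c := by
    rw [Function.IsPeriodicPt, Function.IsFixedPt, iterate_frobenius]
  simp only [← key]
  exact ⟨fun h => h.1.gcd h.2, fun h => ⟨h.trans_dvd (Nat.gcd_dvd_left i s),
    h.trans_dvd (Nat.gcd_dvd_right i s)⟩⟩

lemma frobenius_sub_of_unit {E : Type*} [Field E] (p s : ℕ) [Fact p.Prime] [CharP E p] {x y : E}
    (hx : x ^ (p ^ s + 1) = 1) (hy : y ^ (p ^ s + 1) = 1) :
    (x - y) ^ p ^ s = (y - x) / (x * y) := by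
  have h1 : x ≠ 0 := by rintro rfl; simp at hx
  have h2 : y ≠ 0 := by rintro rfl; simp at hy
  rw [pow_succ] at hx hy
  rw [sub_pow_char_pow, eq_inv_of_mul_eq_one_left hx, eq_inv_of_mul_eq_one_left hy]
  field_simp

/-- Since u^q = 1/u on U_{q+1}, this is the invariance of the cross-ratio under inversion: the
factors xyzw and the signs cancel. -/
lemma crossRatio_pow_of_unit {E : Type*} [Field E] (p s : ℕ) [Fact p.Prime] [CharP E p]
    {x y z w : E} (hx : x ^ (p ^ s + 1) = 1) (hy : y ^ (p ^ s + 1) = 1)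
    (hz : z ^ (p ^ s + 1) = 1) (hw : w ^ (p ^ s + 1) = 1) (hxw : x ≠ w) (hyz : y ≠ z) :
    crossRatio x y z w ^ p ^ s = crossRatio x y z w := by
  have hx0 : x ≠ 0 := by rintro rfl; simp at hx
  have hy0 : y ≠ 0 := by rintro rfl; simp at hy
  have hz0 : z ≠ 0 := by rintro rfl; simp at hz
  have hw0 : w ≠ 0 := by rintro rfl; simp at hw
  have h1 := sub_ne_zero.2 hxw
  have h2 := sub_ne_zero.2 hyz
  have h3 := sub_ne_zero.2 hxw.symm
  have h4 := sub_ne_zero.2 hyz.symm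
  rw [crossRatio, div_pow, mul_pow, mul_pow, frobenius_sub_of_unit p s hx hz,
    frobenius_sub_of_unit p s hy hw, frobenius_sub_of_unit p s hx hw,
    frobenius_sub_of_unit p s hy hz]
  field_simp
  ring

/-- Solving for w gives w = N/D with N = cx(y-z) - y(x-z) and D = c(y-z) - (x-z). For c in F_q the
q-th power map exchanges N and D up to the common factor -1/(xyz), whence w^q = 1/w. -/
lemma exists_unit_crossRatio_eq {E : Type*} [Field E] (p s : ℕ) [Fact p.Prime] [CharP E p]
    {x y z c : E} (hx : x ^ (p ^ s + 1) = 1) (hy : y ^ (p ^ s + 1) = 1)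
    (hz : z ^ (p ^ s + 1) = 1) (hxy : x ≠ y) (hxz : x ≠ z) (hyz : y ≠ z)
    (hc : c ^ p ^ s = c) (hc0 : c ≠ 0) (hc1 : c ≠ 1) :
    ∃ w, w ^ (p ^ s + 1) = 1 ∧ x ≠ w ∧ y ≠ w ∧ z ≠ w ∧ crossRatio x y z w = c := by
  have hx0 : x ≠ 0 := by rintro rfl; simp at hx
  have hy0 : y ≠ 0 := by rintro rfl; simp at hy
  have hz0 : z ≠ 0 := by rintro rfl; simp at hz
  have hDq : (c * (y - z) - (x - z)) ^ p ^ s =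
      -(c * x * (y - z) - y * (x - z)) / (x * y * z) := by
    rw [sub_pow_char_pow, mul_pow, hc, frobenius_sub_of_unit p s hx hz,
      frobenius_sub_of_unit p s hy hz]
    field_simp
    ring
  -- If D = 0 then N = 0 by `hDq`, but xD - N = (x-z)(y-x) ≠ 0.
  have hD : c * (y - z) - (x - z) ≠ 0 := by
    intro h
    rw [h, zero_pow (pow_ne_zero _ (Fact.out : p.Prime).ne_zero)] at hDq
    field_simp at hDq
    have : (x - z) * (y - x) = 0 := by linear_combination -hDq + x * h
    rcases mul_eq_zero.1 this with h | h
    · exact hxz (sub_eq_zero.1 h)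
    · exact hxy (sub_eq_zero.1 h).symm
  have hxq : x ^ p ^ s = x⁻¹ := by rw [pow_succ] at hx; exact eq_inv_of_mul_eq_one_left hx
  have hyq : y ^ p ^ s = y⁻¹ := by rw [pow_succ] at hy; exact eq_inv_of_mul_eq_one_left hy
  have hNq : (c * x * (y - z) - y * (x - z)) ^ p ^ s =
      -(c * (y - z) - (x - z)) / (x * y * z) := by
    rw [sub_pow_char_pow, mul_pow, mul_pow, mul_pow, hc, frobenius_sub_of_unit p s hx hz,
      frobenius_sub_of_unit p s hy hz, hxq, hyq]
    field_simp
    ring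
  have hN : c * x * (y - z) - y * (x - z) ≠ 0 := by
    intro h
    rw [h] at hDq
    simp at hDq
    exact hD hDq.1
  generalize hDe : c * (y - z) - (x - z) = D at *
  generalize hNe : c * x * (y - z) - y * (x - z) = N at *
  have hxw : x - N / D = (x - z) * (y - x) / D := by
    field_simp; rw [← hDe, ← hNe]; ring
  have hyw : y - N / D = c * (y - z) * (y - x) / D := by
    field_simp; rw [← hDe, ← hNe]; ring
  have hzw : z - N / D = (z - x) * (y - z) * (c - 1) / D := by
    field_simp; rw [← hDe, ← hNe]; ring
  have h1 := sub_ne_zero.2 hxy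
  have h1' := sub_ne_zero.2 hxy.symm
  have h2 := sub_ne_zero.2 hyz
  have h3 := sub_ne_zero.2 hxz
  have h3' := sub_ne_zero.2 hxz.symm
  have h4 := sub_ne_zero.2 hc1
  refine ⟨N / D, ?_, ?_, ?_, ?_, ?_⟩
  · rw [pow_succ, div_pow, hDq, hNq]
    field_simp
  · rw [← sub_ne_zero, hxw]; positivity
  · rw [← sub_ne_zero, hyw]; positivity
  · rw [← sub_ne_zero, hzw]; positivity
  · rw [crossRatio, hxw, hyw]
    field_simp

/-- The nonzero solutions form the kernel of the (p^m - 1)-th power map on the cyclic group Eˣ. Its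
order is p^m - 1 because p^m - 1 divides p^t - 1; discarding the identity leaves p^m - 2. -/
lemma card_pow_prime_pow_eq_self {E : Type*} [Field E] [Fintype E] [DecidableEq E] (p m t : ℕ)
    [Fact p.Prime] (hE : Fintype.card E = p ^ t) (hmt : m ∣ t) :
    (Finset.univ.filter fun c : E => c ^ p ^ m = c ∧ c ≠ 0 ∧ c ≠ 1).card = p ^ m - 2 := by
  have hp := (Fact.out : p.Prime)
  have hker := IsCyclic.card_powMonoidHom_ker (G := Eˣ) (p ^ m - 1)
  have hdvd : p ^ m - 1 ∣ p ^ t - 1 := by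
    obtain ⟨k, rfl⟩ := hmt
    rw [pow_mul]
    simpa using Nat.sub_dvd_pow_sub_pow (p ^ m) 1 k
  rw [Nat.card_eq_fintype_card (α := Eˣ), Fintype.card_units, hE, Nat.gcd_eq_right hdvd] at hker
  have : p ^ m - 2 = p ^ m - 1 - 1 := by omega
  rw [this, ← hker, Nat.card_eq_fintype_card, ← Finset.card_univ,
    ← Finset.card_erase_of_mem (Finset.mem_univ (1 : (powMonoidHom (α := Eˣ) (p ^ m - 1)).ker))]
  symm
  have hpm : p ^ m = p ^ m - 1 + 1 := (Nat.sub_add_cancel (Nat.one_le_pow _ _ hp.pos)).symm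
  refine Finset.card_bij (fun u _ => ((u : Eˣ) : E)) ?_ ?_ ?_
  · intro u hu
    have h1 : (u : Eˣ) ^ (p ^ m - 1) = 1 := u.2
    have h2 : ((u : Eˣ) : E) ≠ 1 := by
      intro h
      exact (Finset.mem_erase.1 hu).1 (Subtype.ext (Units.ext h))
    have h3 : ((u : Eˣ) : E) ^ (p ^ m - 1) = 1 := by
      rw [← Units.val_pow_eq_pow_val, h1, Units.val_one]
    simp only [Finset.mem_filter, Finset.mem_univ, true_and]
    refine ⟨?_, Units.ne_zero _, h2⟩
    calc _ = ((u : Eˣ) : E) ^ (p ^ m - 1 + 1) := by rw [← hpm]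
      _ = _ := by rw [pow_succ, h3, one_mul]
  · intro u _ v _ h
    exact Subtype.ext (Units.ext h)
  · intro c hc
    simp only [Finset.mem_filter, Finset.mem_univ, true_and] at hc
    obtain ⟨h1, h2, h3⟩ := hc
    refine ⟨⟨Units.mk0 c h2, ?_⟩, ?_, rfl⟩
    · rw [hpm, pow_succ] at h1
      rw [MonoidHom.mem_ker]
      ext
      simpa using mul_right_cancel₀ h2 (h1.trans (one_mul c).symm)
    · rw [Finset.mem_erase]
      refine ⟨fun h => h3 ?_, Finset.mem_univ _⟩
      have := congrArg (fun u : (powMonoidHom (α := Eˣ) (p ^ m - 1)).ker => ((u : Eˣ) : E)) h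
      simpa using this

/-! ### Blocks as dependent sets of columns. -/

/-- The columns `(1, u, u ^ r, u ^ (r + 1))`, `u ∈ S`, are linearly dependent. -/
def IsDep {E : Type*} [Field E] (r : ℕ) (S : Finset E) : Prop :=
  ∃ v : E → E, (∃ u ∈ S, v u ≠ 0) ∧ ∑ u ∈ S, v u = 0 ∧ ∑ u ∈ S, v u * u = 0 ∧
    ∑ u ∈ S, v u * u ^ r = 0 ∧ ∑ u ∈ S, v u * u ^ (r + 1) = 0

open scoped Classical in
lemma fourMatrix_det_eq_zero_iff_isDep {E : Type*} [Field E] (r : ℕ) {x y z w : E} (hxy : x ≠ y)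
    (hxz : x ≠ z) (hxw : x ≠ w) (hyz : y ≠ z) (hyw : y ≠ w) (hzw : z ≠ w) :
    (fourMatrix r x y z w).det = 0 ↔ IsDep r {x, y, z, w} := by
  have hsum (f : E → E) : ∑ u ∈ ({x, y, z, w} : Finset E), f u = f x + f y + f z + f w := by
    rw [Finset.sum_insert (by simp [*]), Finset.sum_insert (by simp [*]),
      Finset.sum_insert (by simp [*]), Finset.sum_singleton]
    ring
  rw [← Matrix.exists_mulVec_eq_zero_iff]
  simp only [IsDep, hsum]
  constructor
  · rintro ⟨v, hv, h⟩
    have h0 := congrFun h 0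
    have h1 := congrFun h 1
    have h2 := congrFun h 2
    have h3 := congrFun h 3
    simp only [Matrix.mulVec, dotProduct, fourMatrix, Fin.sum_univ_four, Pi.zero_apply] at h0 h1 h2 h3
    simp at h0 h1 h2 h3
    let f : E → E := fun u => if u = x then v 0 else if u = y then v 1 else if u = z then v 2 else v 3
    have fx : f x = v 0 := by simp [f]
    have fy : f y = v 1 := by simp [f, hxy.symm]
    have fz : f z = v 2 := by simp [f, hxz.symm, hyz.symm]
    have fw : f w = v 3 := by simp [f, hxw.symm, hyw.symm, hzw.symm]
    refine ⟨f, ?_, ?_, ?_, ?_, ?_⟩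
    · by_contra! hf
      apply hv
      ext k
      fin_cases k
      · simpa [fx] using hf x (by simp)
      · simpa [fy] using hf y (by simp)
      · simpa [fz] using hf z (by simp)
      · simpa [fw] using hf w (by simp)
    all_goals rw [fx, fy, fz, fw]
    · exact h0
    · linear_combination h1
    · linear_combination h2
    · linear_combination h3
  · rintro ⟨f, ⟨u, hu, hfu⟩, h0, h1, h2, h3⟩
    refine ⟨![f x, f y, f z, f w], ?_, ?_⟩
    · intro h
      have e0 : f x = 0 := congrFun h 0
      have e1 : f y = 0 := congrFun h 1
      have e2 : f z = 0 := congrFun h 2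
      have e3 : f w = 0 := congrFun h 3
      simp only [Finset.mem_insert, Finset.mem_singleton] at hu
      rcases hu with rfl | rfl | rfl | rfl <;> contradiction
    · ext k
      fin_cases k <;> simp [Matrix.mulVec, dotProduct, fourMatrix, Fin.sum_univ_four]
      · exact h0
      · linear_combination h1
      · linear_combination h2
      · linear_combination h3

/-- Any three of the columns `(1, u, u ^ r, u ^ (r + 1))` are linearly independent. -/
lemma sum_columns_three {E ι : Type*} [Field E] (p i : ℕ) [Fact p.Prime] [CharP E p]
    (S : Finset ι) (f v : ι → E) (hf : Set.InjOn f S) (hS : S.card ≤ 3)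
    (h0 : ∑ j ∈ S, v j = 0) (h1 : ∑ j ∈ S, v j * f j = 0) (h2 : ∑ j ∈ S, v j * f j ^ p ^ i = 0)
    (h3 : ∑ j ∈ S, v j * f j ^ (p ^ i + 1) = 0) : ∀ j ∈ S, v j = 0 := by
  classical
  -- The function (u-b)(u-c)^(p^i) is a combination of the four rows. Taking b and c to be the other
  -- points isolates a single coefficient.
  have key (b c : E) : ∑ j ∈ S, v j * ((f j - b) * (f j - c) ^ p ^ i) = 0 := by
    calc _ = ∑ j ∈ S, (v j * f j ^ (p ^ i + 1) - b * (v j * f j ^ p ^ i)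
            - c ^ p ^ i * (v j * f j) + b * c ^ p ^ i * v j) := by
          refine Finset.sum_congr rfl fun j _ => ?_
          rw [sub_pow_char_pow]
          ring
      _ = 0 := by
          rw [Finset.sum_add_distrib, Finset.sum_sub_distrib, Finset.sum_sub_distrib,
            ← Finset.mul_sum, ← Finset.mul_sum, ← Finset.mul_sum, h0, h1, h2, h3]
          ring
  intro j hj
  have hcard : (S.erase j).card ≤ 2 := by rw [Finset.card_erase_of_mem hj]; omega
  obtain ⟨b, c, hbc⟩ : ∃ b c : E, (∀ k ∈ S.erase j, f k = b ∨ f k = c) ∧ f j ≠ b ∧ f j ≠ c := by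
    have hne : ∀ k ∈ S.erase j, f j ≠ f k := fun k hk h =>
      (Finset.mem_erase.1 hk).1 (hf hj (Finset.mem_of_mem_erase hk) h).symm
    rcases Nat.lt_or_ge (S.erase j).card 2 with h | h
    · rcases (S.erase j).eq_empty_or_nonempty with he | ⟨k, hk⟩
      -- With no other point, any value different from `f j` serves.
      · exact ⟨f j + 1, f j + 1, by simp [he], by simp, by simp⟩
      · refine ⟨f k, f k, fun l hl => ?_, hne k hk, hne k hk⟩
        rw [Finset.card_le_one.1 (Nat.le_of_lt_succ h) l hl k hk]
        simp
    · obtain ⟨k, l, -, hkl⟩ := Finset.card_eq_two.1 (le_antisymm hcard h)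
      rw [hkl] at hne ⊢
      refine ⟨f k, f l, ?_, hne k (by simp), hne l (by simp)⟩
      simp
  obtain ⟨h, hb, hc⟩ := hbc
  have hk := key b c
  rw [Finset.sum_eq_single_of_mem j hj] at hk
  · have hb' := sub_ne_zero.2 hb
    have hc' := pow_ne_zero (p ^ i) (sub_ne_zero.2 hc)
    exact (mul_eq_zero.1 hk).resolve_right (mul_ne_zero hb' hc')
  · intro k hk hkj
    rcases h k (Finset.mem_erase.2 ⟨hkj, hk⟩) with h | h
    · rw [h]; ring
    · rw [h, sub_self c, zero_pow (pow_ne_zero _ (Fact.out : p.Prime).ne_zero)]; ring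

open scoped Classical in
/-- The underlying set of field elements of a set of roots of unity. -/
noncomputable def rootValues {E : Type*} [Field E] (l : ℕ) (S : Finset (rootsOfUnity l E)) : Finset E :=
  S.image fun u : rootsOfUnity l E => ((u : Eˣ) : E)

lemma rootsOfUnity_val_injective {E : Type*} [Field E] (l : ℕ) :
    Function.Injective fun u : rootsOfUnity l E => ((u : Eˣ) : E) :=
  fun _ _ h => Subtype.ext (Units.ext h)

lemma pairwise_ne_of_card_eq_four {α : Type*} [DecidableEq α] {x y z w : α}
    (h : ({x, y, z, w} : Finset α).card = 4) :
    x ≠ y ∧ x ≠ z ∧ x ≠ w ∧ y ≠ z ∧ y ≠ w ∧ z ≠ w := by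
  have key (a b c : α) (hs : ({x, y, z, w} : Finset α) ⊆ {a, b, c}) : False := by
    have := (Finset.card_le_card hs).trans Finset.card_le_three
    omega
  refine ⟨?_, ?_, ?_, ?_, ?_, ?_⟩ <;> intro e
  · exact key x z w (by subst e; intro u; simp)
  · exact key x y w (by subst e; intro u; simp; tauto)
  · exact key x y z (by subst e; intro u; simp; tauto)
  · exact key x y w (by subst e; intro u; simp)
  · exact key x y z (by subst e; intro u; simp; tauto)
  · exact key x y z (by subst e; intro u; simp)

/-- Dependence of the columns refers only to the set, so the ordering chosen in the determinant is
immaterial. -/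
lemma mem_detBlocks_iff {E : Type*} [Field E] (l : ℕ) [NeZero l] (r : ℕ)
    (S : Finset (rootsOfUnity l E)) :
    S ∈ detBlocks E l r ↔ S.card = 4 ∧ IsDep r (rootValues l S) := by
  classical
  have hinj := rootsOfUnity_val_injective (E := E) l
  simp only [detBlocks, Finset.mem_filter, Finset.mem_univ, true_and]
  refine and_congr_right fun hS => ?_
  have key {x y z w : rootsOfUnity l E} (hxy : x ≠ y) (hxz : x ≠ z) (hxw : x ≠ w) (hyz : y ≠ z)
      (hyw : y ≠ w) (hzw : z ≠ w) :
      (fourMatrix r ((x : Eˣ) : E) ((y : Eˣ) : E) ((z : Eˣ) : E) ((w : Eˣ) : E)).det = 0 ↔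
        IsDep r (rootValues l {x, y, z, w}) := by
    rw [fourMatrix_det_eq_zero_iff_isDep r (hinj.ne hxy) (hinj.ne hxz) (hinj.ne hxw)
      (hinj.ne hyz) (hinj.ne hyw) (hinj.ne hzw)]
    simp only [rootValues, Finset.image_insert, Finset.image_singleton]
  constructor
  · rintro ⟨x, y, z, w, rfl, h⟩
    obtain ⟨h1, h2, h3, h4, h5, h6⟩ := pairwise_ne_of_card_eq_four hS
    exact (key h1 h2 h3 h4 h5 h6).1 h
  · intro h
    obtain ⟨x, y, z, w, h1, h2, h3, h4, h5, h6, rfl⟩ := Finset.card_eq_four.1 hS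
    exact ⟨x, y, z, w, rfl, (key h1 h2 h3 h4 h5 h6).2 h⟩

/-! ### The 3-design on U_{q+1}. -/

theorem detBlocks_isSimpleDesign {E : Type*} [Field E] [Fintype E] (p s i : ℕ) [Fact p.Prime]
    [CharP E p] (hE : Fintype.card E = p ^ (2 * s))
    (hU : Nat.card (rootsOfUnity (p ^ s + 1) E) = p ^ s + 1) :
    IsSimpleDesign (detBlocks E (p ^ s + 1) (p ^ i)).val 3 (p ^ s + 1) 4
      (p ^ Nat.gcd i s - 2) where
  card_points := hU
  one_le := by norm_num
  le_block := by norm_num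
  card_block b hb := ((mem_detBlocks_iff _ _ b).1 hb).1
  nodup := Finset.nodup _
  regular T hT := by
    classical
    have hinj := rootsOfUnity_val_injective (E := E) (p ^ s + 1)
    have hpow (u : rootsOfUnity (p ^ s + 1) E) : ((u : Eˣ) : E) ^ (p ^ s + 1) = 1 := by
      have h : (u : Eˣ) ^ (p ^ s + 1) = 1 := u.2
      rw [← Units.val_pow_eq_pow_val, h, Units.val_one]
    obtain ⟨x, y, z, hxy, hxz, hyz, rfl⟩ := Finset.card_eq_three.1 hT
    have hmem (w : rootsOfUnity (p ^ s + 1) E) (hxw : x ≠ w) (hyw : y ≠ w) (hzw : z ≠ w) :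
        ({x, y, z, w} : Finset _) ∈ detBlocks E (p ^ s + 1) (p ^ i) ↔
          crossRatio ((x : Eˣ) : E) ((y : Eˣ) : E) ((z : Eˣ) : E) ((w : Eˣ) : E) ^ p ^ i =
            crossRatio ((x : Eˣ) : E) ((y : Eˣ) : E) ((z : Eˣ) : E) ((w : Eˣ) : E) := by
      rw [mem_detBlocks_iff, ← fourMatrix_det_eq_zero_iff p i (hinj.ne hxw) (hinj.ne hyz),
        fourMatrix_det_eq_zero_iff_isDep _ (hinj.ne hxy) (hinj.ne hxz) (hinj.ne hxw)
      (hinj.ne hyz) (hinj.ne hyw) (hinj.ne hzw)]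
      have : ({x, y, z, w} : Finset (rootsOfUnity (p ^ s + 1) E)).card = 4 :=
        Finset.card_eq_four.2 ⟨x, y, z, w, hxy, hxz, hxw, hyz, hyw, hzw, rfl⟩
      simp only [rootValues, Finset.image_insert, Finset.image_singleton, this, true_and]
    rw [← card_pow_prime_pow_eq_self p (Nat.gcd i s) (2 * s) hE
      ((Nat.gcd_dvd_right i s).mul_left 2), Multiset.countP_eq_card_filter]
    trans (Finset.filter (fun b => {x, y, z} ⊆ b) (detBlocks E (p ^ s + 1) (p ^ i))).card
    · rw [Finset.card_def, Finset.filter_val]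
      congr!
    symm
    -- The count is a bijection from the admissible cross-ratios c to the blocks through x, y, z,
    -- sending c to the block with fourth point `g c`.
    have hlift (c : E) (h : c ^ p ^ Nat.gcd i s = c ∧ c ≠ 0 ∧ c ≠ 1) :
        ∃ w : rootsOfUnity (p ^ s + 1) E, x ≠ w ∧ y ≠ w ∧ z ≠ w ∧
          crossRatio ((x : Eˣ) : E) ((y : Eˣ) : E) ((z : Eˣ) : E) ((w : Eˣ) : E) = c := by
      obtain ⟨w, h1, h2, h3, h4, h5⟩ := exists_unit_crossRatio_eq p s (hpow x) (hpow y) (hpow z)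
        (hinj.ne hxy) (hinj.ne hxz) (hinj.ne hyz) ((pow_prime_pow_gcd p i s c).2 h.1).2 h.2.1 h.2.2
      have hw : w ≠ 0 := by rintro rfl; simp at h1
      refine ⟨⟨Units.mk0 w hw, ?_⟩, ?_, ?_, ?_, h5⟩
      · rw [mem_rootsOfUnity]; ext; simpa using h1
      all_goals rintro rfl; simp at h2 h3 h4
    choose! g hg using hlift
    refine Finset.card_bij (fun c _ => {x, y, z, g c}) ?_ ?_ ?_
    · intro c hc
      simp only [Finset.mem_filter, Finset.mem_univ, true_and] at hc ⊢
      obtain ⟨h1, h2, h3, h4⟩ := hg c hc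
      refine ⟨?_, ?_⟩
      · rw [hmem _ h1 h2 h3, h4]
        exact ((pow_prime_pow_gcd p i s c).2 hc.1).1
      · intro u; simp only [Finset.mem_insert, Finset.mem_singleton]; tauto
    · intro c hc d hd hcd
      simp only [Finset.mem_filter, Finset.mem_univ, true_and] at hc hd
      obtain ⟨h1, h2, h3, h4⟩ := hg c hc
      obtain ⟨-, -, -, h4'⟩ := hg d hd
      have : g c ∈ ({x, y, z, g d} : Finset _) := by rw [← hcd]; simp
      simp only [Finset.mem_insert, Finset.mem_singleton, h1.symm, h2.symm, h3.symm,
        false_or] at this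
      rw [← h4, ← h4', this]
    · intro b hb
      simp only [Finset.mem_filter] at hb
      have hb4 := ((mem_detBlocks_iff _ _ b).1 hb.1).1
      obtain ⟨w, hw⟩ : ∃ w, b \ {x, y, z} = {w} := by
        rw [← Finset.card_eq_one, Finset.card_sdiff_of_subset hb.2, hb4, hT]
      have hbw : b = {x, y, z, w} := by
        rw [← Finset.sdiff_union_of_subset hb.2, hw]
        ext u; simp only [Finset.mem_union, Finset.mem_insert, Finset.mem_singleton]; tauto
      have hwm : w ∈ b \ {x, y, z} := by rw [hw]; simp
      simp only [Finset.mem_sdiff, Finset.mem_insert, Finset.mem_singleton, not_or] at hwm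
      obtain ⟨-, hx, hy, hz⟩ := hwm
      set c := crossRatio ((x : Eˣ) : E) ((y : Eˣ) : E) ((z : Eˣ) : E) ((w : Eˣ) : E) with hcdef
      have hxw := sub_ne_zero.2 (hinj.ne (Ne.symm hx))
      have hyw := sub_ne_zero.2 (hinj.ne (Ne.symm hy))
      have hzw := sub_ne_zero.2 (hinj.ne (Ne.symm hz))
      have hxy' := sub_ne_zero.2 (hinj.ne hxy)
      have hxz' := sub_ne_zero.2 (hinj.ne hxz)
      have hyz' := sub_ne_zero.2 (hinj.ne hyz)
      have hc : c ^ p ^ Nat.gcd i s = c ∧ c ≠ 0 ∧ c ≠ 1 := by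
        refine ⟨(pow_prime_pow_gcd p i s c).1 ⟨?_, ?_⟩, ?_, ?_⟩
        · rw [← hmem w (Ne.symm hx) (Ne.symm hy) (Ne.symm hz), ← hbw]
          exact hb.1
        · exact crossRatio_pow_of_unit p s (hpow x) (hpow y) (hpow z) (hpow w)
            (hinj.ne (Ne.symm hx)) (hinj.ne hyz)
        · rw [hcdef, crossRatio]; positivity
        · rw [← sub_ne_zero, hcdef, crossRatio_sub_one (hinj.ne (Ne.symm hx)) (hinj.ne hyz)]
          positivity
      refine ⟨c, by simpa using hc, ?_⟩
      have hgc : g c = w := hinj (crossRatio_injective (hinj.ne hxy) (hinj.ne hxz) (hinj.ne hyz)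
        (hinj.ne (hg c hc).1) (hinj.ne (Ne.symm hx)) (hg c hc).2.2.2)
      rw [hgc, hbw]

/-! ### Descent of minimum weight words to the base field. -/

lemma count_divMultiplicity {α : Type*} [DecidableEq α] (a : ℕ) (S : Multiset α) (x : α) :
    (divMultiplicity a S).count x = S.count x / a := by
  classical
  have hS : divMultiplicity a S =
      ∑ y ∈ S.toFinset, Multiset.replicate (S.count y / a) y := by
    unfold divMultiplicity
    congr!
  rw [hS, Multiset.count_sum']
  simp only [Multiset.count_replicate]
  by_cases hx : x ∈ S
  · rw [Finset.sum_eq_single x]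
    · rw [if_pos rfl]
    · intro b _ hb
      rw [if_neg hb]
    · intro h
      exact absurd (Multiset.mem_toFinset.2 hx) h
  · rw [Multiset.count_eq_zero_of_notMem hx, Nat.zero_div]
    refine Finset.sum_eq_zero fun b hb => ?_
    rw [if_neg]
    rintro rfl
    exact hx (Multiset.mem_toFinset.1 hb)

/-- The polynomial X^q - X has at most q roots in E, and the image of F already supplies q of them.
-/
lemma mem_range_algebraMap_of_pow_card {F E : Type*} [Field F] [Fintype F] [Field E] [Algebra F E]
    {a : E} (ha : a ^ Fintype.card F = a) : ∃ b : F, algebraMap F E b = a := by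
  classical
  have hne : (X ^ Fintype.card F - X : E[X]) ≠ 0 :=
    FiniteField.X_pow_card_sub_X_ne_zero E Fintype.one_lt_card
  have hroot (c : E) : c ∈ (X ^ Fintype.card F - X : E[X]).roots.toFinset ↔
      c ^ Fintype.card F = c := by
    rw [Multiset.mem_toFinset, mem_roots hne]
    simp [IsRoot, sub_eq_zero]
  have hsub : Finset.univ.image (algebraMap F E) ⊆
      (X ^ Fintype.card F - X : E[X]).roots.toFinset := by
    intro c hc
    obtain ⟨b, -, rfl⟩ := Finset.mem_image.1 hc
    rw [hroot, ← map_pow, FiniteField.pow_card]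
  have heq := Finset.eq_of_subset_of_card_le hsub (by
    rw [Finset.card_image_of_injective _ (algebraMap F E).injective, Finset.card_univ]
    refine (Multiset.toFinset_card_le _).trans ((card_roots' _).trans ?_)
    rw [FiniteField.X_pow_card_sub_X_natDegree_eq E Fintype.one_lt_card])
  have := (hroot a).2 ha
  rw [← heq] at this
  obtain ⟨b, -, hb⟩ := Finset.mem_image.1 this
  exact ⟨b, hb⟩

lemma mem_codeSupport {F : Type*} [Field F] {n : ℕ} {c : Fin n → F} {j : Fin n} :
    j ∈ codeSupport c ↔ c j ≠ 0 := by
  simp [codeSupport]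

lemma codeSupport_algebraMap {F E : Type*} [Field F] [Field E] [Algebra F E] {n : ℕ}
    (c : Fin n → F) : codeSupport (fun j => algebraMap F E (c j)) = codeSupport c := by
  ext j
  simp [mem_codeSupport]

lemma codeSupport_subset_iff {F : Type*} [Field F] {n : ℕ} {c : Fin n → F} {b : Finset (Fin n)} :
    codeSupport c ⊆ b ↔ ∀ j ∉ b, c j = 0 := by
  constructor
  · intro h j hj
    by_contra h0
    exact hj (h (mem_codeSupport.2 h0))
  · intro h j hj
    by_contra h0
    exact mem_codeSupport.1 hj (h j h0)

/-- In a linear code with minimum distance at least `k`, a word supported in a `k`-set is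
determined by any of its coordinates in that set. -/
lemma eq_of_apply_eq {E : Type*} [Field E] {n k : ℕ} (K : Submodule E (Fin n → E))
    (hK : ∀ v ∈ K, (codeSupport v).card < k → v = 0) {b : Finset (Fin n)} (hb : b.card = k)
    {v w : Fin n → E} (hv : v ∈ K) (hw : w ∈ K) (hvb : codeSupport v ⊆ b)
    (hwb : codeSupport w ⊆ b) {j : Fin n} (hj : j ∈ b) (h : v j = w j) : v = w := by
  rw [← sub_eq_zero]
  refine hK _ (K.sub_mem hv hw) ?_
  have hsub : codeSupport (v - w) ⊆ b.erase j := by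
    rw [codeSupport_subset_iff]
    intro l hl
    rw [Finset.mem_erase, not_and_or, not_not] at hl
    rcases hl with rfl | hl
    · simp [h]
    · simp [codeSupport_subset_iff.1 hvb l hl, codeSupport_subset_iff.1 hwb l hl]
  have h1 := Finset.card_le_card hsub
  rw [Finset.card_erase_of_mem hj] at h1
  have h2 := Finset.card_pos.2 ⟨j, hj⟩
  omega

/-- A minimum weight word over an extension field in a Frobenius stable code is proportional to a
word over the base field. -/
lemma exists_codeSupport_eq {F E : Type*} [Field F] [Fintype F] [Field E] [Algebra F E] {n k : ℕ}
    (C : Submodule F (Fin n → F)) (K : Submodule E (Fin n → E))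
    (hCK : ∀ c : Fin n → F, c ∈ C ↔ (fun j => algebraMap F E (c j)) ∈ K)
    (hfrob : ∀ v ∈ K, (fun j => v j ^ Fintype.card F) ∈ K)
    (hK : ∀ v ∈ K, (codeSupport v).card < k → v = 0) {b : Finset (Fin n)} (hb : b.card = k)
    {v : Fin n → E} (hv : v ∈ K) (hv0 : v ≠ 0) (hvb : codeSupport v ⊆ b) :
    ∃ c ∈ C, codeSupport c = b := by
  have hsupp : codeSupport v = b := Finset.eq_of_subset_of_card_le hvb (by
    by_contra! hlt
    exact hv0 (hK v hv (hb ▸ hlt)))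
  obtain ⟨j, hj⟩ : b.Nonempty := by
    rw [Finset.nonempty_iff_ne_empty]
    rintro rfl
    apply hv0
    ext j
    exact codeSupport_subset_iff.1 hvb j (by simp)
  have hvj : v j ≠ 0 := mem_codeSupport.1 (hsupp ▸ hj)
  have hw : (v j)⁻¹ • v ∈ K := K.smul_mem _ hv
  have hws : codeSupport ((v j)⁻¹ • v) ⊆ b := by
    rw [codeSupport_subset_iff] at hvb ⊢
    intro l hl
    simp [hvb l hl]
  -- Normalised to be 1 at j, the word and its Frobenius image agree at j and are supported in b, so
  -- they coincide.
  have hfix : (fun l => ((v j)⁻¹ • v) l ^ Fintype.card F) = (v j)⁻¹ • v := by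
    refine eq_of_apply_eq K hK hb (hfrob _ hw) hw ?_ hws hj ?_
    · rw [codeSupport_subset_iff] at hws ⊢
      intro l hl
      simp [hws l hl, Fintype.card_ne_zero]
    · simp [hvj]
  choose c hc using fun l => mem_range_algebraMap_of_pow_card (F := F) (congrFun hfix l)
  have hc' : (fun l => algebraMap F E (c l)) = (v j)⁻¹ • v := funext hc
  refine ⟨c, (hCK c).2 (hc' ▸ hw), ?_⟩
  rw [← codeSupport_algebraMap (E := E), hc', ← hsupp]
  ext l
  simp [mem_codeSupport, hvj]

lemma hammingNorm_eq_card_codeSupport {F : Type*} [Field F] [DecidableEq F] {n : ℕ}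
    (c : Fin n → F) : hammingNorm c = (codeSupport c).card := by
  unfold hammingNorm codeSupport
  congr!

/-- Each block carries a word over F by descent, and any two codewords with that support are
proportional. It thus supports exactly q - 1 codewords and has multiplicity one after division.
Nonemptiness of B makes the minimum distance equal to k rather than larger. -/
theorem minWeightBlocks_eq {F E : Type*} [Field F] [Fintype F] [Field E] [Algebra F E] {n k : ℕ}
    (C : Submodule F (Fin n → F)) (K : Submodule E (Fin n → E)) (hk : k ≠ 0)
    (hCK : ∀ c : Fin n → F, c ∈ C ↔ (fun j => algebraMap F E (c j)) ∈ K)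
    (hfrob : ∀ v ∈ K, (fun j => v j ^ Fintype.card F) ∈ K)
    (hK : ∀ v ∈ K, (codeSupport v).card < k → v = 0) (B : Finset (Finset (Fin n)))
    (hB : ∀ b, b ∈ B ↔ b.card = k ∧ ∃ v ∈ K, v ≠ 0 ∧ codeSupport v ⊆ b) (hne : B.Nonempty) :
    minWeightBlocks C = B.val := by
  classical
  have hC : ∀ c ∈ C, (codeSupport c).card < k → c = 0 := by
    intro c hc h
    have := hK _ ((hCK c).1 hc) (by rwa [codeSupport_algebraMap])
    ext j
    simpa using congrFun this j
  have hCB (b : Finset (Fin n)) (hb : b ∈ B) : ∃ c ∈ C, codeSupport c = b := by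
    obtain ⟨h1, v, h2, h3, h4⟩ := (hB b).1 hb
    exact exists_codeSupport_eq C K hCK hfrob hK h1 h2 h3 h4
  have hBC (c : Fin n → F) (hc : c ∈ C) (h : (codeSupport c).card = k) : codeSupport c ∈ B := by
    refine (hB _).2 ⟨h, _, (hCK c).1 hc, ?_, (codeSupport_algebraMap c).le⟩
    intro h0
    have : codeSupport c = ∅ := by
      rw [← codeSupport_algebraMap (E := E), h0]
      simp [codeSupport]
    simp [this] at h
    exact hk h.symm
  have hmin : codeMinDist C = k := by
    obtain ⟨b, hb⟩ := hne
    obtain ⟨c, hc, hcb⟩ := hCB b hb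
    have hck : (codeSupport c).card = k := hcb ▸ ((hB b).1 hb).1
    unfold codeMinDist
    refine le_antisymm (Nat.sInf_le ⟨c, hc, ?_, ?_⟩) ?_
    · rintro rfl
      simp [codeSupport] at hck
      exact hk hck.symm
    · rw [hammingNorm_eq_card_codeSupport, hck]
    · refine le_csInf ⟨k, c, hc, ?_, ?_⟩ ?_
      · rintro rfl
        simp [codeSupport] at hck
        exact hk hck.symm
      · rw [hammingNorm_eq_card_codeSupport, hck]
      · rintro w ⟨d, hd, hd0, rfl⟩
        rw [hammingNorm_eq_card_codeSupport]
        by_contra! hlt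
        exact hd0 (hC d hd hlt)
  unfold minWeightBlocks codeBlocks
  rw [hmin]
  ext b
  rw [count_divMultiplicity, Multiset.count_map, ← Finset.filter_val, ← Finset.card_def,
    Finset.filter_filter]
  simp only [hammingNorm_eq_card_codeSupport]
  by_cases hb : b ∈ B
  · obtain ⟨c, hc, hcb⟩ := hCB b hb
    have hbk := ((hB b).1 hb).1
    obtain ⟨j, hj⟩ : b.Nonempty := Finset.card_pos.1 (by omega)
    have hcj : c j ≠ 0 := mem_codeSupport.1 (hcb ▸ hj)
    rw [Multiset.count_eq_one_of_mem B.nodup hb]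
    refine (congrArg (· / _) ?_).trans
      (Nat.div_self (Nat.sub_pos_of_lt (Fintype.one_lt_card (α := F))))
    rw [← Fintype.card_units, ← Finset.card_univ]
    symm
    refine Finset.card_bij (fun (a : Fˣ) _ => (a : F) • c) ?_ ?_ ?_
    · intro a _
      have : codeSupport ((a : F) • c) = b := by
        rw [← hcb]
        ext l
        simp [mem_codeSupport]
      simp [this, hbk, C.smul_mem _ hc]
    · intro a _ a' _ h
      ext
      simpa [hcj] using congrFun h j
    · intro d hd
      simp only [Finset.mem_filter, Finset.mem_univ, true_and] at hd
      obtain ⟨⟨hd1, -⟩, rfl⟩ := hd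
      have hdj : d j ≠ 0 := mem_codeSupport.1 hj
      -- The scalar is forced by the coordinate j, which already determines the word.
      refine ⟨Units.mk0 (d j / c j) (div_ne_zero hdj hcj), Finset.mem_univ _, ?_⟩
      refine eq_of_apply_eq C hC hbk (C.smul_mem _ hc) hd1 ?_ le_rfl hj ?_
      · rw [← hcb, codeSupport_subset_iff]
        intro l hl
        simp [mem_codeSupport] at hl
        simp [hl]
      · simp [hcj]
  · rw [Multiset.count_eq_zero_of_notMem (by simpa using hb), Finset.card_eq_zero.2, Nat.zero_div]
    rw [Finset.filter_eq_empty_iff]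
    rintro c - ⟨⟨hc, hck⟩, rfl⟩
    exact hb (hBC c hc hck)

/-! ### BCH codes -/

/-- As g divides X^n - 1, the ideal it generates in the quotient pulls back to (g). -/
lemma mem_cyclicCode_iff {F : Type*} [Field F] {n : ℕ} {g : F[X]} (hg : g ∣ X ^ n - 1)
    (c : Fin n → F) : c ∈ cyclicCode n g ↔ g ∣ ∑ j : Fin n, monomial (j : ℕ) (c j) := by
  have h : wordToQuotient F n c = Ideal.Quotient.mk (Ideal.span {(X ^ n - 1 : F[X])})
      (∑ j : Fin n, monomial (j : ℕ) (c j)) := by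
    simp [wordToQuotient]
  rw [cyclicCode, Submodule.mem_comap, Submodule.restrictScalars_mem, h,
    Ideal.mem_span_singleton]
  constructor
  · rintro ⟨a, ha⟩
    obtain ⟨a, rfl⟩ := Ideal.Quotient.mk_surjective a
    rw [← map_mul, Ideal.Quotient.eq, Ideal.mem_span_singleton] at ha
    exact (dvd_sub_left (Dvd.intro a rfl)).1 (hg.trans ha)
  · exact fun h => map_dvd _ h

lemma bchGenerator_dvd_iff (F : Type*) [Field F] {E : Type*} [Field E] [Algebra F E]
    (h : ℕ) (β : E) (f : F[X]) :
    bchGenerator F 3 h β ∣ f ↔ aeval (β ^ h) f = 0 ∧ aeval (β ^ (h + 1)) f = 0 := by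
  classical
  unfold bchGenerator
  rw [@Finset.lcm_dvd_iff _ _ _ (_)]
  simp only [← minpoly.dvd_iff, Finset.mem_range]
  constructor
  · intro H
    exact ⟨H 0 (by norm_num), H 1 (by norm_num)⟩
  · rintro ⟨h0, h1⟩ j hj
    interval_cases j
    · exact h0
    · exact h1

lemma mem_bchCode_iff (F : Type*) [Field F] {E : Type*} [Field E] [Algebra F E] {n : ℕ} (h : ℕ)
    {β : E} (hβ : β ^ n = 1) (c : Fin n → F) :
    c ∈ bchCode F n 3 h β ↔ ∑ j : Fin n, algebraMap F E (c j) * (β ^ (j : ℕ)) ^ h = 0 ∧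
      ∑ j : Fin n, algebraMap F E (c j) * (β ^ (j : ℕ)) ^ (h + 1) = 0 := by
  have hpow (k : ℕ) : (β ^ k) ^ n = 1 := by rw [← pow_mul, mul_comm, pow_mul, hβ, one_pow]
  rw [bchCode, mem_cyclicCode_iff, bchGenerator_dvd_iff]
  · simp only [map_sum, aeval_monomial, ← pow_mul, mul_comm]
  · rw [bchGenerator_dvd_iff]
    simp [hpow]

/-! ### Isomorphisms of designs. -/

lemma DesignIso.symm {P Q : Type*} {B : Multiset (Finset P)} {B' : Multiset (Finset Q)}
    (h : DesignIso B B') : DesignIso B' B := by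
  obtain ⟨e, rfl⟩ := h
  refine ⟨e.symm, ?_⟩
  rw [Multiset.map_map]
  conv_rhs => rw [← Multiset.map_id B]
  refine Multiset.map_congr rfl fun b _ => ?_
  ext x
  simp

lemma DesignIso.trans {P Q R : Type*} {B : Multiset (Finset P)} {B' : Multiset (Finset Q)}
    {B'' : Multiset (Finset R)} (h : DesignIso B B') (h' : DesignIso B' B'') :
    DesignIso B B'' := by
  obtain ⟨e, rfl⟩ := h
  obtain ⟨e', rfl⟩ := h'
  refine ⟨e.trans e', ?_⟩
  rw [Multiset.map_map]
  refine Multiset.map_congr rfl fun b _ => ?_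
  rw [Function.comp_apply, Finset.map_map]
  rfl

lemma IsSimpleDesign.of_designIso {P Q : Type*} {B : Multiset (Finset P)}
    {B' : Multiset (Finset Q)} {t n k l : ℕ} (hB : IsSimpleDesign B t n k l)
    (h : DesignIso B B') : IsSimpleDesign B' t n k l := by
  classical
  obtain ⟨e, rfl⟩ := h
  refine { card_points := ?_, one_le := hB.one_le, le_block := hB.le_block, card_block := ?_,
           regular := ?_, nodup := ?_ }
  · rw [← Nat.card_congr e, hB.card_points]
  · intro b hb
    obtain ⟨a, ha, rfl⟩ := Multiset.mem_map.1 hb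
    rw [Finset.card_map, hB.card_block a ha]
  · intro T hT
    rw [← hB.regular (T.map e.symm.toEmbedding) (by rw [Finset.card_map, hT]),
      Multiset.countP_map, Multiset.countP_eq_card_filter]
    congr 1
    refine Multiset.filter_congr fun b _ => ?_
    constructor
    · intro h x hx
      have := h (Finset.mem_map_equiv.1 hx)
      simpa using this
    · intro h x hx
      have : e.symm x ∈ T.map e.symm.toEmbedding := by simpa using hx
      simpa using h this
  · exact hB.nodup.map (Finset.map_injective _)

/-! ### The four parity checks and their rescaling. -/

/-- The code over the extension field with the zeros `β ^ h`, `β ^ (h + 1)` and their inverses. -/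
def symmetricCode {E : Type*} [Field E] (n h : ℕ) (β : E) : Submodule E (Fin n → E) where
  carrier := {v | (∑ j, v j * (β ^ (j : ℕ)) ^ h = 0 ∧ ∑ j, v j * (β ^ (j : ℕ)) ^ (h + 1) = 0) ∧
    ∑ j, v j * ((β ^ (j : ℕ))⁻¹) ^ h = 0 ∧ ∑ j, v j * ((β ^ (j : ℕ))⁻¹) ^ (h + 1) = 0}
  add_mem' := by
    rintro v w ⟨⟨h1, h2⟩, h3, h4⟩ ⟨⟨h1', h2'⟩, h3', h4'⟩
    simp only [Set.mem_ofPred_eq, Pi.add_apply, add_mul, Finset.sum_add_distrib, h1, h2, h3, h4,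
      h1', h2', h3', h4', add_zero, and_self]
  zero_mem' := by simp
  smul_mem' := by
    rintro a v ⟨⟨h1, h2⟩, h3, h4⟩
    simp only [Set.mem_ofPred_eq, Pi.smul_apply, smul_eq_mul, mul_assoc, ← Finset.mul_sum, h1, h2,
      h3, h4, mul_zero, and_self]

lemma mem_symmetricCode {E : Type*} [Field E] {n h : ℕ} {β : E} {v : Fin n → E} :
    v ∈ symmetricCode n h β ↔
      (∑ j, v j * (β ^ (j : ℕ)) ^ h = 0 ∧ ∑ j, v j * (β ^ (j : ℕ)) ^ (h + 1) = 0) ∧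
        ∑ j, v j * ((β ^ (j : ℕ))⁻¹) ^ h = 0 ∧ ∑ j, v j * ((β ^ (j : ℕ))⁻¹) ^ (h + 1) = 0 :=
  Iff.rfl

lemma sum_mul_pow_frobenius {E : Type*} [Field E] (p s n k : ℕ) [Fact p.Prime] [CharP E p]
    (u v : Fin n → E) (hu : ∀ j, u j ^ (p ^ s + 1) = 1) :
    (∑ j, v j * u j ^ k) ^ p ^ s = ∑ j, v j ^ p ^ s * (u j)⁻¹ ^ k := by
  rw [sum_pow_char_pow]
  refine Finset.sum_congr rfl fun j _ => ?_
  have := hu j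
  rw [pow_succ] at this
  rw [mul_pow, pow_right_comm, eq_inv_of_mul_eq_one_left this]

/-- The q-th power map inverts β^j, so it swaps the two pairs of checks. This stability is what
permits descent to F. -/
lemma symmetricCode_frobenius {E : Type*} [Field E] (p s n h : ℕ) [Fact p.Prime] [CharP E p]
    {β : E} (hβ : β ^ (p ^ s + 1) = 1) {v : Fin n → E} (hv : v ∈ symmetricCode n h β) :
    (fun j => v j ^ p ^ s) ∈ symmetricCode n h β := by
  have hu (j : Fin n) : (β ^ (j : ℕ)) ^ (p ^ s + 1) = 1 := by
    rw [pow_right_comm, hβ, one_pow]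
  have hu' (j : Fin n) : (β ^ (j : ℕ))⁻¹ ^ (p ^ s + 1) = 1 := by
    rw [inv_pow, hu, inv_one]
  have h0 : p ^ s ≠ 0 := pow_ne_zero _ (Fact.out : p.Prime).ne_zero
  rw [mem_symmetricCode] at hv ⊢
  obtain ⟨⟨h1, h2⟩, h3, h4⟩ := hv
  have key (k : ℕ) (hk : ∑ j, v j * (β ^ (j : ℕ)) ^ k = 0) :
      ∑ j, v j ^ p ^ s * (β ^ (j : ℕ))⁻¹ ^ k = 0 := by
    rw [← sum_mul_pow_frobenius p s n k _ v hu, hk, zero_pow h0]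
  have key' (k : ℕ) (hk : ∑ j, v j * (β ^ (j : ℕ))⁻¹ ^ k = 0) :
      ∑ j, v j ^ p ^ s * (β ^ (j : ℕ)) ^ k = 0 := by
    have := sum_mul_pow_frobenius p s n k _ v hu'
    simp only [inv_inv] at this
    rw [← this, hk, zero_pow h0]
  exact ⟨⟨key' _ h3, key' _ h4⟩, key _ h1, key _ h2⟩

/-- Coefficients in F are fixed by the q-th power map, so the checks at the inverse zeros follow
from the other two. -/
lemma mem_bchCode_iff_mem_symmetricCode {F E : Type*} [Field F] [Fintype F] [Field E] [Algebra F E]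
    (p s h : ℕ) [Fact p.Prime] [CharP E p] (hF : Fintype.card F = p ^ s) {β : E}
    (hβ : β ^ (p ^ s + 1) = 1) (c : Fin (p ^ s + 1) → F) :
    c ∈ bchCode F (p ^ s + 1) 3 h β ↔
      (fun j => algebraMap F E (c j)) ∈ symmetricCode (p ^ s + 1) h β := by
  rw [mem_bchCode_iff F h hβ, mem_symmetricCode]
  refine (and_iff_left_of_imp ?_).symm
  have hu (j : Fin (p ^ s + 1)) : (β ^ (j : ℕ)) ^ (p ^ s + 1) = 1 := by
    rw [pow_right_comm, hβ, one_pow]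
  have h0 : p ^ s ≠ 0 := pow_ne_zero _ (Fact.out : p.Prime).ne_zero
  have hq (a : F) : algebraMap F E a ^ p ^ s = algebraMap F E a := by
    rw [← map_pow, ← hF, FiniteField.pow_card]
  have key (k : ℕ) (hk : ∑ j, algebraMap F E (c j) * (β ^ (j : ℕ)) ^ k = 0) :
      ∑ j, algebraMap F E (c j) * (β ^ (j : ℕ))⁻¹ ^ k = 0 := by
    have := sum_mul_pow_frobenius p s _ k _ (fun j => algebraMap F E (c j)) hu
    simp only [hq] at this
    rw [← this, hk, zero_pow h0]
  exact fun H => ⟨key _ H.1, key _ H.2⟩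

/-- After rescaling the coordinates, the symmetric code has the parity checks
`1, u, u ^ r, u ^ (r + 1)`. -/
lemma exists_rescaling {E : Type*} [Field E] {q r h n : ℕ} {β : E} (hβ : β ^ (q + 1) = 1)
    (hh : 2 * h + r = q ∨ 2 * h + 1 = r) :
    ∃ g : Fin n → E, (∀ j, g j ≠ 0) ∧ ∀ v, v ∈ symmetricCode n h β ↔
      ∑ j, v j * g j = 0 ∧ ∑ j, v j * g j * β ^ (j : ℕ) = 0 ∧
        ∑ j, v j * g j * (β ^ (j : ℕ)) ^ r = 0 ∧
          ∑ j, v j * g j * (β ^ (j : ℕ)) ^ (r + 1) = 0 := by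
  have hβ0 : β ≠ 0 := by rintro rfl; simp at hβ
  have hu0 (j : Fin n) : β ^ (j : ℕ) ≠ 0 := pow_ne_zero _ hβ0
  have hu (j : Fin n) : (β ^ (j : ℕ)) ^ (q + 1) = 1 := by
    rw [pow_right_comm, hβ, one_pow]
  rcases hh with hh | hh
  -- With u = β^j and 2h + r = q, the factor u^h turns 1, u, u^r, u^(r+1) into u^h, u^(h+1),
  -- u^(-h-1), u^(-h).
  · refine ⟨fun j => (β ^ (j : ℕ)) ^ h, fun j => pow_ne_zero _ (hu0 j), fun v => ?_⟩
    have e1 (j : Fin n) : (β ^ (j : ℕ)) ^ h * β ^ (j : ℕ) = (β ^ (j : ℕ)) ^ (h + 1) :=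
      (pow_succ _ _).symm
    have e2 (j : Fin n) : (β ^ (j : ℕ)) ^ h * (β ^ (j : ℕ)) ^ r = (β ^ (j : ℕ))⁻¹ ^ (h + 1) := by
      rw [inv_pow]
      apply eq_inv_of_mul_eq_one_left
      rw [← pow_add, ← pow_add, ← hu j]
      congr 1
      omega
    have e3 (j : Fin n) : (β ^ (j : ℕ)) ^ h * (β ^ (j : ℕ)) ^ (r + 1) = (β ^ (j : ℕ))⁻¹ ^ h := by
      rw [inv_pow]
      apply eq_inv_of_mul_eq_one_left
      rw [← pow_add, ← pow_add, ← hu j]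
      congr 1
      omega
    simp only [mem_symmetricCode, mul_assoc, e1, e2, e3]
    tauto
  -- With r = 2h + 1, the factor u^(-h-1) gives u^(-h-1), u^(-h), u^h, u^(h+1).
  · refine ⟨fun j => (β ^ (j : ℕ))⁻¹ ^ (h + 1), fun j => pow_ne_zero _ (inv_ne_zero (hu0 j)),
      fun v => ?_⟩
    have e1 (j : Fin n) : (β ^ (j : ℕ))⁻¹ ^ (h + 1) * β ^ (j : ℕ) = (β ^ (j : ℕ))⁻¹ ^ h := by
      rw [pow_succ, mul_assoc, inv_mul_cancel₀ (hu0 j), mul_one]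
    have e2 (j : Fin n) : (β ^ (j : ℕ))⁻¹ ^ (h + 1) * (β ^ (j : ℕ)) ^ r = (β ^ (j : ℕ)) ^ h := by
      rw [inv_pow, inv_mul_eq_iff_eq_mul₀ (pow_ne_zero _ (hu0 j)), ← pow_add]
      congr 1
      omega
    have e3 (j : Fin n) :
        (β ^ (j : ℕ))⁻¹ ^ (h + 1) * (β ^ (j : ℕ)) ^ (r + 1) = (β ^ (j : ℕ)) ^ (h + 1) := by
      rw [inv_pow, inv_mul_eq_iff_eq_mul₀ (pow_ne_zero _ (hu0 j)), ← pow_add]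
      congr 1
      omega
    simp only [mem_symmetricCode, mul_assoc, e1, e2, e3]
    tauto

/-- The enumeration `j ↦ β ^ j` of the roots of unity by the coordinate positions. -/
lemma exists_equiv_rootsOfUnity {E : Type*} [Field E] {n : ℕ} [NeZero n] {β : E}
    (hβ : IsPrimitiveRoot β n) :
    ∃ e : Fin n ≃ rootsOfUnity n E, ∀ j, ((e j : Eˣ) : E) = β ^ (j : ℕ) := by
  have hpow (j : Fin n) : (β ^ (j : ℕ)) ^ n = 1 := by rw [pow_right_comm, hβ.pow_eq_one, one_pow]
  let f : Fin n → rootsOfUnity n E := fun j => rootsOfUnity.mkOfPowEq (β ^ (j : ℕ)) (hpow j)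
  have hf : Function.Injective f := by
    intro j k hjk
    have := congrArg (fun u : rootsOfUnity n E => ((u : Eˣ) : E)) hjk
    simp only [f, rootsOfUnity.coe_mkOfPowEq] at this
    exact Fin.ext (hβ.pow_inj j.2 k.2 this)
  have hbij : Function.Bijective f :=
    hf.bijective_of_nat_card_le (by rw [hβ.card_rootsOfUnity, Nat.card_fin])
  exact ⟨Equiv.ofBijective f hbij, fun j => rootsOfUnity.coe_mkOfPowEq _⟩

-- Passes from coefficients attached to field elements to words indexed by coordinates; g absorbs
-- the rescaling of the checks.
open scoped Classical in
lemma isDep_image_iff {E ι : Type*} [Field E] [Fintype ι] (r : ℕ) (b : Finset ι)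
    (f g : ι → E) (hf : Function.Injective f) (hg : ∀ j, g j ≠ 0) :
    IsDep r (b.image f) ↔ ∃ v : ι → E, (∑ j, v j * g j = 0 ∧ ∑ j, v j * g j * f j = 0 ∧
      ∑ j, v j * g j * f j ^ r = 0 ∧ ∑ j, v j * g j * f j ^ (r + 1) = 0) ∧ v ≠ 0 ∧
        ∀ j ∉ b, v j = 0 := by
  unfold IsDep
  simp only [Finset.sum_image hf.injOn]
  constructor
  · rintro ⟨w, ⟨u, hu, hwu⟩, h0, h1, h2, h3⟩
    have hsum (t : ι → E) : ∑ j, (if j ∈ b then w (f j) / g j else 0) * g j * t j =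
        ∑ j ∈ b, w (f j) * t j := by
      simp only [ite_mul, zero_mul, Finset.sum_ite_mem, Finset.univ_inter]
      exact Finset.sum_congr rfl fun j _ => by rw [div_mul_cancel₀ _ (hg j)]
    have hsum0 := hsum fun _ => 1
    simp only [mul_one] at hsum0
    refine ⟨fun j => if j ∈ b then w (f j) / g j else 0, ?_, ?_, ?_⟩
    · rw [hsum0, hsum, hsum, hsum]
      exact ⟨h0, h1, h2, h3⟩
    · obtain ⟨j, hj, rfl⟩ := Finset.mem_image.1 hu
      intro h
      have := congrFun h j
      simp [hj, hwu, hg j] at this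
    · intro j hj
      simp [hj]
  · rintro ⟨v, ⟨h0, h1, h2, h3⟩, hv, hvb⟩
    have hsum (t : ι → E) : ∑ j ∈ b, v j * g j * t j = ∑ j, v j * g j * t j :=
      Finset.sum_subset (Finset.subset_univ b) fun j _ hj => by simp [hvb j hj]
    have hsum0 := hsum fun _ => 1
    simp only [mul_one] at hsum0
    -- The default 0 off the range of f is harmless, since only values at `f j` enter the sums.
    refine ⟨Function.extend f (fun j => v j * g j) 0, ?_, ?_⟩
    · obtain ⟨j, hj⟩ := Function.ne_iff.1 hv
      refine ⟨f j, Finset.mem_image_of_mem f ?_, ?_⟩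
      · by_contra h
        exact hj (hvb j h)
      · rw [hf.extend_apply]
        exact mul_ne_zero hj (hg j)
    · simp only [hf.extend_apply]
      rw [hsum0, hsum, hsum, hsum]
      exact ⟨h0, h1, h2, h3⟩

/-! ### The isomorphism with the code designs. -/

theorem designIso_minWeightBlocks_bchCode {F E : Type*} [Field F] [Fintype F] [Field E]
    [Algebra F E] (p s i h : ℕ) [Fact p.Prime] [CharP E p] (hF : Fintype.card F = p ^ s) {β : E}
    (hβ : IsPrimitiveRoot β (p ^ s + 1)) (hh : 2 * h + p ^ i = p ^ s ∨ 2 * h + 1 = p ^ i)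
    (hne : (detBlocks E (p ^ s + 1) (p ^ i)).Nonempty) :
    DesignIso (detBlocks E (p ^ s + 1) (p ^ i)).val
      (minWeightBlocks (bchCode F (p ^ s + 1) 3 h β)) := by
  classical
  obtain ⟨e, he⟩ := exists_equiv_rootsOfUnity hβ
  obtain ⟨g, hg0, hg⟩ := exists_rescaling (n := p ^ s + 1) hβ.pow_eq_one hh
  have hinj : Function.Injective fun j : Fin (p ^ s + 1) => β ^ (j : ℕ) :=
    fun j k hjk => Fin.ext (hβ.pow_inj j.2 k.2 hjk)
  refine ⟨e.symm, ?_⟩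
  symm
  refine (minWeightBlocks_eq (k := 4) (bchCode F (p ^ s + 1) 3 h β)
    (symmetricCode (p ^ s + 1) h β) (by norm_num)
    (mem_bchCode_iff_mem_symmetricCode p s h hF hβ.pow_eq_one)
    (fun v hv => by rw [hF]; exact symmetricCode_frobenius p s _ h hβ.pow_eq_one hv) ?_
    ((detBlocks E (p ^ s + 1) (p ^ i)).map e.symm.finsetCongr.toEmbedding) ?_ ?_).trans ?_
  · intro v hv hcard
    obtain ⟨h0, h1, h2, h3⟩ := (hg v).1 hv
    have hsum (t : Fin (p ^ s + 1) → E) :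
        ∑ j ∈ codeSupport v, v j * g j * t j = ∑ j, v j * g j * t j :=
      Finset.sum_subset (Finset.subset_univ _) fun j _ hj => by
        rw [mem_codeSupport, not_not] at hj
        simp [hj]
    have hsum0 := hsum fun _ => 1
    simp only [mul_one] at hsum0
    have key := sum_columns_three p i (codeSupport v) (fun j => β ^ (j : ℕ)) (fun j => v j * g j)
      hinj.injOn (by omega) (hsum0.trans h0) ((hsum _).trans h1) ((hsum _).trans h2)
      ((hsum _).trans h3)
    ext j
    by_contra hj
    exact mul_ne_zero hj (hg0 j) (key j (mem_codeSupport.2 hj))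
  · intro b
    have himage : rootValues (p ^ s + 1) (b.map e.toEmbedding) =
        b.image fun j : Fin (p ^ s + 1) => β ^ (j : ℕ) := by
      rw [rootValues, Finset.map_eq_image, Finset.image_image]
      exact Finset.image_congr fun j _ => he j
    rw [Finset.mem_map_equiv]
    change b.map e.toEmbedding ∈ _ ↔ _
    rw [mem_detBlocks_iff, Finset.card_map, himage, isDep_image_iff _ b _ g hinj hg0]
    simp only [← hg, codeSupport_subset_iff]
  · simpa using hne
  · rw [Finset.map_val]
    rfl

theorem mainTheorem9 (p s i m : ℕ) (hp : p.Prime) (hs : 1 < s) (hi : 0 < i) (his : i < s)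
    (hm : Nat.gcd i s = m)
    (F E : Type*) [Field F] [Fintype F] [Field E] [Algebra F E]
    (hF : Fintype.card F = p ^ s) (hE : Module.finrank F E = 2)
    (β : E) (hβ : IsPrimitiveRoot β (p ^ s + 1)) :
    -- the determinant blocks form a simple design
    IsSimpleDesign (detBlocks E (p ^ s + 1) (p ^ i)).val 3 (p ^ s + 1) 4 (p ^ m - 2) ∧
    -- it is isomorphic to the one supported by the minimum weight codewords
    (3 ≤ p ^ m → ∀ h : ℕ,
      (h = (p ^ s - p ^ i) / 2 ∨ (Odd p ∧ h = (p ^ i - 1) / 2)) →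
        IsSimpleDesign (minWeightBlocks (bchCode F (p ^ s + 1) 3 h β))
          3 (p ^ s + 1) 4 (p ^ m - 2) ∧
        DesignIso (detBlocks E (p ^ s + 1) (p ^ i)).val
          (minWeightBlocks (bchCode F (p ^ s + 1) 3 h β))) ∧
    -- for odd characteristic the two families of codes give isomorphic designs
    (Odd p →
      DesignIso
        (minWeightBlocks (bchCode F (p ^ s + 1) 3 ((p ^ s - p ^ i) / 2) β))
        (minWeightBlocks (bchCode F (p ^ s + 1) 3 ((p ^ i - 1) / 2) β))) := by
  classical
  subst hm
  have : Fact p.Prime := ⟨hp⟩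
  have : FiniteDimensional F E := FiniteDimensional.of_finrank_pos (by omega)
  have : Finite E := Module.finite_of_finite F
  let _ : Fintype E := Fintype.ofFinite E
  have : CharP F p := by
    obtain ⟨p', hp'⟩ := CharP.exists F
    obtain ⟨k, hp'p, hk⟩ := FiniteField.card F p'
    have : p' ∣ p ^ s := hF ▸ hk ▸ dvd_pow_self p' k.ne_zero
    exact (Nat.prime_dvd_prime_iff_eq hp'p hp).1 (hp'p.dvd_of_dvd_pow this) ▸ hp'
  have : CharP E p := charP_of_injective_algebraMap (algebraMap F E).injective p
  have hEcard : Fintype.card E = p ^ (2 * s) := by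
    rw [Module.card_eq_pow_finrank (K := F), hF, hE, ← pow_mul, mul_comm]
  have hdesign := detBlocks_isSimpleDesign (E := E) p s i hEcard hβ.card_rootsOfUnity
  have hlt : p ^ i < p ^ s := Nat.pow_lt_pow_right hp.one_lt his
  have hpi : 1 ≤ p ^ i := Nat.one_le_pow _ _ hp.pos
  have hiso : 3 ≤ p ^ Nat.gcd i s → ∀ h : ℕ,
      (h = (p ^ s - p ^ i) / 2 ∨ (Odd p ∧ h = (p ^ i - 1) / 2)) →
        DesignIso (detBlocks E (p ^ s + 1) (p ^ i)).val
          (minWeightBlocks (bchCode F (p ^ s + 1) 3 h β)) := by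
    intro hm h hh
    refine designIso_minWeightBlocks_bchCode p s i h hF hβ ?_ ?_
    · rcases hh with rfl | ⟨hodd, rfl⟩
      · left
        -- Both exponents are positive, so the two powers have the same parity, also for p = 2, and
        -- the halving is exact.
        have : Even (p ^ s - p ^ i) := by
          rw [Nat.even_sub hlt.le, Nat.even_pow' (by omega), Nat.even_pow' (by omega)]
        have := Nat.two_mul_div_two_of_even this
        omega
      · right
        obtain ⟨k, hk⟩ := hodd.pow (n := i)
        omega
    -- A block exists: q + 1 ≥ 3 provides a 3-subset, and it lies in p^m - 2 > 0 blocks.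
    · have h3 : p ^ Nat.gcd i s ≤ p ^ s :=
        Nat.pow_le_pow_right hp.pos (Nat.le_of_dvd (by omega) (Nat.gcd_dvd_right i s))
      let _ : Fintype (rootsOfUnity (p ^ s + 1) E) := Fintype.ofFinite _
      obtain ⟨T, -, hT⟩ := Finset.exists_subset_card_eq
        (s := (Finset.univ : Finset (rootsOfUnity (p ^ s + 1) E))) (n := 3) (by
          rw [Finset.card_univ, ← Nat.card_eq_fintype_card, hβ.card_rootsOfUnity]
          omega)
      have hreg := hdesign.regular T hT
      obtain ⟨b, hb, -⟩ := (@Multiset.countP_pos _ _ (_) _).1 (hreg ▸ (by omega : 0 < p ^ Nat.gcd i s - 2))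
      exact ⟨b, hb⟩
  refine ⟨hdesign, fun hm h hh => ?_, fun hodd => ?_⟩
  · exact ⟨hdesign.of_designIso (hiso hm h hh), hiso hm h hh⟩
  · have hm : 3 ≤ p ^ Nat.gcd i s := by
      have hp3 : 3 ≤ p := by
        have := hp.two_le
        obtain ⟨k, hk⟩ := hodd
        omega
      exact hp3.trans (Nat.le_self_pow (Nat.gcd_pos_of_pos_left s hi).ne' p)
    exact (hiso hm _ (Or.inl rfl)).symm.trans (hiso hm _ (Or.inr ⟨hodd, rfl⟩))
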